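/- Let $H(x,y)=x^2+y^2$ on $\mathbb{C}^2$, $B=\mathbb{C}\setminus\{0\}$, $E=H^{-1}(B)$, $S_1=\{H=1\}$, and let $\pi:\mathbb{C}\to B$, $\pi(z)=e^{2\pi i z}$. Let $\nu:\mathbb{C}\to S_1$, $\nu(\zeta)=(\cos\zeta,\sin\zeta)$, let $\delta_0=S_1\cap\mathbb{R}^2$ and let $C_0=\nu(\{\tfrac12<\operatorname{Im}\zeta<\tfrac32\})$, a cylinder on $S_1$ whose closure is disjoint from $\delta_0$. A (smooth) Dehn twist of $C_0$ of handedness $\sigma\in\{1,-1\}$ is a diffeomorphism $D$ of $S_1$ of the form $D(\nu(\zeta))=\nu(\zeta+2\pi\sigma\varphi(\operatorname{Im}\zeta))$ with $\varphi:\mathbb{R}\to\mathbb{R}$ smooth, $\varphi(t)=0$ for $t\le\tfrac12$ and $\varphi(t)=1$ for $t\ge\tfrac32$. Such twists exist for both handednesses. Let $\tilde D_0$ be any of them and put $D_0=\tilde D_0^{-1}$. Then $\tilde D_0$ represents the monodromy of $H:E\to B$ around $0$: there is a smooth family of diffeomorphisms $F_s:S_1\to H^{-1}(e^{2\pi i s})$,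 $s\in\mathbb{R}$, with $F_0=\mathrm{id}$ and $F_1=\tilde D_0$. The map $D_0$ is the identity on $S_1\setminus C_0$. Moreover, there is a smooth covering map $\Pi:\mathbb{C}\times S_1\to E$ (a surjective covering map that is a local diffeomorphism) such that: 1. $H\circ\Pi=\pi\circ pr_{\mathbb{C}}$, where $pr_{\mathbb{C}}(z,p)=z$; 2. the group of deck transformations of $\Pi$ is the group $\hat\Gamma$ generated by $(z,p)\mapsto(z+1,D_0(p))$. The quotient $(\mathbb{C}\times S_1)/\hat\Gamma$, with the quotient topology, has a smooth structure for which the quotient map is a local diffeomorphism, and $\Pi$ induces a diffeomorphism $\Phi:(\mathbb{C}\times S_1)/\hat\Gamma\to E$ with $H(\Phi([z,p]))=\pi(z)$; that is, the two are isomorphic as smooth bundles over $B$. -/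

import Mathlib

open scoped Manifold ContDiff

noncomputable section

namespace CylinderBundle

/-- The polynomial `H(x, y) = x² + y²` on `ℂ²`. -/
def H (q : ℂ × ℂ) : ℂ := q.1 ^ 2 + q.2 ^ 2

/-- The punctured plane `B = ℂ ∖ {0}` of regular values of `H`. -/
def B : TopologicalSpace.Opens ℂ := ⟨{h | h ≠ 0}, isOpen_ne⟩

/-- The total space `E = H⁻¹(B)`, an open subset of `ℂ²`. -/
def E : TopologicalSpace.Opens (ℂ × ℂ) :=
  ⟨{q | H q ≠ 0}, by
    have h : Continuous H := by unfold H; fun_prop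
    exact isOpen_ne.preimage h⟩

/-- The bundle projection `H : E → B`. -/
def HE (q : E) : B := ⟨H q.1, q.2⟩

/-- The universal covering `π : ℂ → B`, `π(z) = e^{2πiz}`. -/
def piMap (z : ℂ) : B := ⟨Complex.exp (2 * Real.pi * Complex.I * z), Complex.exp_ne_zero _⟩

/-- The model fibre `S₁ = {x² + y² = 1} ⊂ ℂ²`, with the subspace topology. -/
def S₁ : Type := {q : ℂ × ℂ // H q = 1}

instance : TopologicalSpace S₁ := inferInstanceAs (TopologicalSpace {q : ℂ × ℂ // H q = 1})

instance : Nonempty S₁ := ⟨⟨(1, 0), by simp [H]⟩⟩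

/-- The inclusion `S₁ → ℂ²`. -/
def S₁.coe (p : S₁) : ℂ × ℂ := p.1

/-- The restriction to `S₁` of the linear function `x + iy`. -/
def S₁.chart (p : S₁) : ℂ := p.1.1 + Complex.I * p.1.2

/-- The inverse parametrization `ℂ ∖ {0} → S₁` of `x + iy`. -/
def S₁.param (u : B) : S₁ :=
  ⟨((u.1 + u.1⁻¹) / 2, (u.1 - u.1⁻¹) / (2 * Complex.I)), by
    have hu : u.1 ≠ 0 := u.2
    have hI : Complex.I ^ 2 = -1 := Complex.I_sq
    have hI0 : Complex.I ≠ 0 := Complex.I_ne_zero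
    unfold H
    simp only [div_pow, mul_pow, hI]
    field_simp
    ring⟩

theorem S₁.chart_ne_zero (p : S₁) : p.chart ≠ 0 := by
  intro h
  have hp : p.1.1 ^ 2 + p.1.2 ^ 2 = 1 := p.2
  have hI : Complex.I ^ 2 = -1 := Complex.I_sq
  have h' : p.1.1 + Complex.I * p.1.2 = 0 := h
  have : (p.1.1 + Complex.I * p.1.2) * (p.1.1 - Complex.I * p.1.2) = 1 := by
    linear_combination hp - p.1.2 ^ 2 * hI
  rw [h', zero_mul] at this
  exact zero_ne_one this

/-- `x + iy` is a homeomorphism of `S₁` onto `ℂ ∖ {0}`. -/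
def S₁.homeo : S₁ ≃ₜ B where
  toFun p := ⟨p.chart, p.chart_ne_zero⟩
  invFun := S₁.param
  left_inv p := by
    have hp : p.1.1 ^ 2 + p.1.2 ^ 2 = 1 := p.2
    have hI : Complex.I ^ 2 = -1 := Complex.I_sq
    have hI0 : Complex.I ≠ 0 := Complex.I_ne_zero
    have hinv : (p.1.1 + Complex.I * p.1.2)⁻¹ = p.1.1 - Complex.I * p.1.2 := by
      apply inv_eq_of_mul_eq_one_right
      linear_combination hp - p.1.2 ^ 2 * hI
    apply Subtype.ext
    apply Prod.ext
    · change (p.1.1 + Complex.I * p.1.2 + (p.1.1 + Complex.I * p.1.2)⁻¹) / 2 = p.1.1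
      rw [hinv]; ring
    · change (p.1.1 + Complex.I * p.1.2 - (p.1.1 + Complex.I * p.1.2)⁻¹) / (2 * Complex.I) = p.1.2
      rw [hinv]; field_simp; ring
  right_inv u := by
    have hI0 : Complex.I ≠ 0 := Complex.I_ne_zero
    have hu : u.1 ≠ 0 := u.2
    apply Subtype.ext
    change (u.1 + u.1⁻¹) / 2 + Complex.I * ((u.1 - u.1⁻¹) / (2 * Complex.I)) = u.1
    field_simp; ring
  continuous_toFun := by
    refine Continuous.subtype_mk ?_ _
    have h : Continuous (fun p : S₁ => p.1) := continuous_subtype_val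
    exact h.fst.add (continuous_const.mul h.snd)
  continuous_invFun := by
    refine Continuous.subtype_mk ?_ _
    have h : Continuous (fun u : B => u.1) := continuous_subtype_val
    have h' : Continuous (fun u : B => u.1⁻¹) := h.inv₀ (fun u => u.2)
    exact ((h.add h').div_const _).prodMk ((h.sub h').div_const _)

theorem S₁.isOpenEmbedding_chart : Topology.IsOpenEmbedding S₁.chart :=
  (B.2.isOpenEmbedding_subtypeVal).comp S₁.homeo.isOpenEmbedding

/-- `S₁` as a manifold, with the single global chart `x + iy : S₁ → ℂ`. By `S₁.contMDiff_iff` below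
this is its structure of a submanifold of `ℂ²`. -/
instance : ChartedSpace ℂ S₁ := S₁.isOpenEmbedding_chart.singletonChartedSpace

instance : IsManifold 𝓘(ℝ, ℂ) ∞ S₁ := S₁.isOpenEmbedding_chart.isManifold_singleton

theorem S₁.contMDiff_chart : ContMDiff 𝓘(ℝ, ℂ) 𝓘(ℝ, ℂ) ∞ S₁.chart :=
  contMDiff_isOpenEmbedding S₁.isOpenEmbedding_chart

theorem S₁.contMDiff_coe : ContMDiff 𝓘(ℝ, ℂ) 𝓘(ℝ, ℂ × ℂ) ∞ S₁.coe := by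
  have key : ∀ p : S₁, S₁.coe p = ((p.chart + p.chart⁻¹) / 2,
      (p.chart - p.chart⁻¹) / (2 * Complex.I)) := fun p =>
    congrArg Subtype.val (S₁.homeo.left_inv p).symm
  rw [show S₁.coe = (fun u : ℂ => ((u + u⁻¹) / 2, (u - u⁻¹) / (2 * Complex.I))) ∘ S₁.chart from
    funext key]
  intro p
  refine ContMDiffAt.comp p ?_ (S₁.contMDiff_chart p)
  rw [contMDiffAt_iff_contDiffAt]
  have h : ContDiffAt ℝ ∞ (fun u : ℂ => u⁻¹) p.chart := contDiffAt_inv ℝ p.chart_ne_zero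
  exact ((contDiffAt_id.add h).div_const _).prodMk ((contDiffAt_id.sub h).div_const _)

/-- A map into `S₁` is smooth if and only if it is smooth as a map into `ℂ²`. -/
theorem S₁.contMDiff_iff {V W M : Type*} [NormedAddCommGroup V] [NormedSpace ℝ V]
    [TopologicalSpace W] (I : ModelWithCorners ℝ V W) [TopologicalSpace M] [ChartedSpace W M]
    (f : M → S₁) :
    ContMDiff I 𝓘(ℝ, ℂ) ∞ f ↔ ContMDiff I 𝓘(ℝ, ℂ × ℂ) ∞ (fun x => (f x).coe) := by
  refine ⟨fun h => S₁.contMDiff_coe.comp h, fun h => ?_⟩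
  refine ContMDiff.of_comp_isOpenEmbedding S₁.isOpenEmbedding_chart ?_
  have hl : ContMDiff 𝓘(ℝ, ℂ × ℂ) 𝓘(ℝ, ℂ) ∞ (fun q : ℂ × ℂ => q.1 + Complex.I * q.2) := by
    rw [contMDiff_iff_contDiff]
    exact contDiff_fst.add (contDiff_const.mul contDiff_snd)
  exact hl.comp h

/-- The universal covering `ν : ℂ → S₁`, `ν(ζ) = (cos ζ, sin ζ)`. -/
def nu (ζ : ℂ) : S₁ := ⟨(Complex.cos ζ, Complex.sin ζ), Complex.cos_sq_add_sin_sq ζ⟩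

/-- The real unit circle `δ₀ = S₁ ∩ ℝ²`. -/
def delta₀ : Set S₁ := {p | p.coe.1.im = 0 ∧ p.coe.2.im = 0}

/-- The cylinder `C₀ = ν({1/2 < Im ζ < 3/2})` on `S₁`. -/
def C₀ : Set S₁ := nu '' {ζ | 1 / 2 < ζ.im ∧ ζ.im < 3 / 2}

/-- `D` is a smooth Dehn twist of the cylinder `C₀`, of handedness `σ = ±1`: in the coordinate `ζ`
on `S₁ = ν(ℂ)`, where `Re ζ` is the angle modulo `2π` and `Im ζ` the height, it rotates the circle
at height `t` by the angle `2πσ φ(t)`, where the smooth function `φ` is `0` below the cylinder and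
`1` above it. -/
def IsDehnTwist (σ : ℤˣ) (D : S₁ ≃ₘ^∞⟮𝓘(ℝ, ℂ), 𝓘(ℝ, ℂ)⟯ S₁) : Prop :=
  ∃ φ : ℝ → ℝ, ContDiff ℝ ∞ φ ∧ (∀ t ≤ 1 / 2, φ t = 0) ∧ (∀ t ≥ 3 / 2, φ t = 1) ∧
    ∀ ζ : ℂ, D (nu ζ) = nu (ζ + ((2 * Real.pi * (σ : ℤ) * φ ζ.im : ℝ) : ℂ))

/-- `f : S₁ → S₁` is a geometric monodromy of `H : E → B` along the loop `s ↦ e^{2πis}`,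
`0 ≤ s ≤ 1`: there is a smooth family of diffeomorphisms `F s` of `S₁` onto the fibre
`H⁻¹(e^{2πis})`, with `F 0` the identity and `F 1 = f`. (A smooth bijection onto the fibre is
a diffeomorphism onto it when its differential is injective everywhere.) -/
def IsMonodromy (f : S₁ → S₁) : Prop :=
  ∃ F : ℝ → S₁ → E,
    ContMDiff (𝓘(ℝ, ℝ).prod 𝓘(ℝ, ℂ)) 𝓘(ℝ, ℂ × ℂ) ∞ (fun x : ℝ × S₁ => F x.1 x.2) ∧
    (∀ s, Set.BijOn (F s) Set.univ (HE ⁻¹' {piMap s})) ∧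
    (∀ s p, Function.Injective (mfderiv 𝓘(ℝ, ℂ) 𝓘(ℝ, ℂ × ℂ) (F s) p)) ∧
    (∀ p, (F 0 p : ℂ × ℂ) = p.coe) ∧ (∀ p, (F 1 p : ℂ × ℂ) = (f p).coe)

/-- `f` is a smooth covering map: a surjective covering map which is a local diffeomorphism. -/
def IsSmoothCovering (f : ℂ × S₁ → E) : Prop :=
  Function.Surjective f ∧ IsCoveringMap f ∧
    IsLocalDiffeomorph (𝓘(ℝ, ℂ).prod 𝓘(ℝ, ℂ)) 𝓘(ℝ, ℂ × ℂ) ∞ f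

/-- The group of deck transformations of a map `f`. -/
def deckGroup {X Y : Type*} [TopologicalSpace X] (f : X → Y) : Subgroup (X ≃ₜ X) where
  carrier := {g | ∀ x, f (g x) = f x}
  mul_mem' {g h} hg hh x := (hg (h x)).trans (hh x)
  one_mem' _ := rfl
  inv_mem' {g} hg x := by
    have h := hg (g⁻¹ x)
    rw [← h]
    exact congrArg f (g.apply_symm_apply x)

/-- The transformation `(z, p) ↦ (z + 1, D(p))` of `ℂ × S₁`. -/
def gammaHat₀ (D : S₁ ≃ₜ S₁) : (ℂ × S₁) ≃ₜ (ℂ × S₁) :=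
  (Homeomorph.addRight (1 : ℂ)).prodCongr D

/-- The group `Γ̂` generated by `(z, p) ↦ (z + 1, D(p))`. -/
def GammaHat (D : S₁ ≃ₜ S₁) : Subgroup ((ℂ × S₁) ≃ₜ (ℂ × S₁)) :=
  Subgroup.zpowers (gammaHat₀ D)

/-- The orbit equivalence relation of `Γ̂` on `ℂ × S₁`. -/
def orbitSetoid (D : S₁ ≃ₜ S₁) : Setoid (ℂ × S₁) where
  r x y := ∃ g ∈ GammaHat D, g x = y
  iseqv :=
    { refl := fun _ => ⟨1, one_mem _, rfl⟩
      symm := by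
        rintro x y ⟨g, hg, rfl⟩
        exact ⟨g⁻¹, inv_mem hg, g.symm_apply_apply x⟩
      trans := by
        rintro x y z ⟨g, hg, rfl⟩ ⟨h, hh, rfl⟩
        exact ⟨h * g, mul_mem hh hg, rfl⟩ }

/-- The quotient `(ℂ × S₁) / Γ̂`, with the quotient topology. -/
abbrev QuotientSpace (D : S₁ ≃ₜ S₁) : Type := Quotient (orbitSetoid D)

/-- The quotient map `ℂ × S₁ → (ℂ × S₁) / Γ̂`. -/
def toQuotient (D : S₁ ≃ₜ S₁) (x : ℂ × S₁) : QuotientSpace D := Quotient.mk (orbitSetoid D) x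

theorem piMap_add_one (z : ℂ) : piMap (z + 1) = piMap z := by
  apply Subtype.ext
  change Complex.exp _ = Complex.exp _
  rw [mul_add, mul_one, Complex.exp_add, Complex.exp_two_pi_mul_I, mul_one]

theorem piMap_fst_of_mem (D : S₁ ≃ₜ S₁) (g : (ℂ × S₁) ≃ₜ (ℂ × S₁)) (hg : g ∈ GammaHat D)
    (x : ℂ × S₁) : piMap (g x).1 = piMap x.1 := by
  have hle : GammaHat D ≤ deckGroup (fun x : ℂ × S₁ => piMap x.1) := by
    refine (Subgroup.zpowers_le (G := (ℂ × S₁) ≃ₜ (ℂ × S₁))).2 ?_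
    intro x
    exact piMap_add_one x.1
  exact hle hg x

/-- The bundle projection `(ℂ × S₁) / Γ̂ → B`, `[z, p] ↦ π(z)`. -/
def quotientProj (D : S₁ ≃ₜ S₁) : QuotientSpace D → B :=
  Quotient.lift (fun x : ℂ × S₁ => piMap x.1) (by
    rintro x y ⟨g, hg, rfl⟩
    exact (piMap_fst_of_mem D g hg x).symm)

end CylinderBundle

end

open CylinderBundle

noncomputable section

namespace CylinderBundle

/-! In the coordinates `u = x + iy`, `v = x - iy` one has `H = uv`, so `u` identifies every fibre
over `B` with `ℂ ∖ {0}`, hence with `S₁`. The bundle is therefore globally trivial: `fiberMap` sends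
`(z, p)` to the point with `u = p.chart`, `v = π(z)/u`, and is the quotient of `ℂ × S₁` by the
translations `z ↦ z + n` (`fiberMap_eq_iff`).

A Dehn twist of `C₀` rotates the circle at height `t` by `ψ t`, with `ψ = 2πσφ`. Rotating by `s * ψ
t` instead gives a one-parameter group from the identity to the twist (`twist_twist`). This isotopy
is not supported in `C₀`: above the cylinder it ends in a full turn. That is why a twist of either
handedness can represent the monodromy of a trivial bundle.

Let `unroll` be `fiberMap` precomposed with the shear `(z, p) ↦ (z, twist ψ (Re z) p)`. The shear
conjugates `(z, p) ↦ (z + 1, twist ψ (-1) p)` to the translation by `1`, so `unroll` is a covering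
whose fibres are the orbits of `Γ̂` (`unroll_eq_iff_zpow`). Its restrictions to real `z` give the
monodromy family; connectedness gives the deck group; and the smooth structure of the quotient is
transported from `E`. -/

/-- The point of `ℂ²` with `x + iy = u` and `x - iy = v`. -/
def ofUV (u v : ℂ) : ℂ × ℂ := ((u + v) / 2, (u - v) / (2 * Complex.I))

theorem H_ofUV (u v : ℂ) : H (ofUV u v) = u * v := by
  have hI : Complex.I ^ 2 = -1 := Complex.I_sq
  simp only [H, ofUV, div_pow, mul_pow, hI]
  ring

theorem ofUV_fst_add (u v : ℂ) : (ofUV u v).1 + Complex.I * (ofUV u v).2 = u := by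
  have hI0 : Complex.I ≠ 0 := Complex.I_ne_zero
  simp only [ofUV]
  field_simp
  ring

theorem ofUV_add_sub (q : ℂ × ℂ) :
    ofUV (q.1 + Complex.I * q.2) (q.1 - Complex.I * q.2) = q := by
  have hI0 : Complex.I ≠ 0 := Complex.I_ne_zero
  apply Prod.ext
  · simp only [ofUV]; ring
  · simp only [ofUV]; field_simp; ring

theorem add_mul_sub (q : ℂ × ℂ) :
    (q.1 + Complex.I * q.2) * (q.1 - Complex.I * q.2) = H q := by
  have hI : Complex.I ^ 2 = -1 := Complex.I_sq
  simp only [H]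
  linear_combination - q.2 ^ 2 * hI

theorem S₁.chart_injective : Function.Injective S₁.chart := S₁.isOpenEmbedding_chart.injective

theorem S₁.chart_param (u : B) : (S₁.param u).chart = u.1 :=
  congrArg Subtype.val (S₁.homeo.right_inv u)

theorem S₁.coe_eq_ofUV (p : S₁) : p.coe = ofUV p.chart p.chart⁻¹ :=
  congrArg Subtype.val (S₁.homeo.left_inv p).symm

theorem chart_nu (ζ : ℂ) : (nu ζ).chart = Complex.exp (ζ * Complex.I) := by
  change Complex.cos ζ + Complex.I * Complex.sin ζ = _
  rw [Complex.exp_mul_I]; ring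

theorem norm_chart_nu (ζ : ℂ) : ‖(nu ζ).chart‖ = Real.exp (-ζ.im) := by
  rw [chart_nu, Complex.norm_exp]; simp

theorem nu_surjective : Function.Surjective nu := by
  intro p
  refine ⟨Complex.log p.chart / Complex.I, S₁.chart_injective ?_⟩
  rw [chart_nu, div_mul_cancel₀ _ Complex.I_ne_zero, Complex.exp_log p.chart_ne_zero]

theorem continuous_nu : Continuous nu :=
  Continuous.subtype_mk (Complex.continuous_cos.prodMk Complex.continuous_sin) _

/-- Needed for the uniqueness of lifts that determines the deck group. -/
instance : ConnectedSpace S₁ := nu_surjective.connectedSpace continuous_nu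

/-! ### Height and rotations on the cylinder `S₁` -/

/-- The height on the cylinder `S₁`: the imaginary part of `ζ` at `ν(ζ)`. -/
def S₁.height (p : S₁) : ℝ := -Real.log ‖p.chart‖

theorem height_nu (ζ : ℂ) : (nu ζ).height = ζ.im := by
  rw [S₁.height, norm_chart_nu, Real.log_exp, neg_neg]

theorem S₁.contMDiff_height : ContMDiff 𝓘(ℝ, ℂ) 𝓘(ℝ, ℝ) ∞ S₁.height := by
  intro p
  have h : ContDiffAt ℝ ∞ (fun u : ℂ => -Real.log ‖u‖) p.chart :=
    ((contDiffAt_norm ℝ p.chart_ne_zero).log (norm_ne_zero_iff.2 p.chart_ne_zero)).neg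
  exact (contMDiffAt_iff_contDiffAt.2 h).comp p (S₁.contMDiff_chart p)

/-- The rotation of `S₁` by the real angle `θ`. -/
def S₁.rot (θ : ℝ) (p : S₁) : S₁ :=
  S₁.param ⟨Complex.exp (θ * Complex.I) * p.chart, mul_ne_zero (Complex.exp_ne_zero _) p.chart_ne_zero⟩

theorem S₁.chart_rot (θ : ℝ) (p : S₁) :
    (p.rot θ).chart = Complex.exp (θ * Complex.I) * p.chart := S₁.chart_param _

theorem S₁.height_rot (θ : ℝ) (p : S₁) : (p.rot θ).height = p.height := by
  rw [S₁.height, S₁.height, S₁.chart_rot, norm_mul, Complex.norm_exp_ofReal_mul_I, one_mul]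

theorem S₁.rot_rot (θ θ' : ℝ) (p : S₁) : (p.rot θ).rot θ' = p.rot (θ' + θ) := by
  apply S₁.chart_injective
  simp only [S₁.chart_rot]
  rw [← mul_assoc, ← Complex.exp_add]
  push_cast
  ring_nf

theorem S₁.rot_zero (p : S₁) : p.rot 0 = p := by
  apply S₁.chart_injective
  simp [S₁.chart_rot]

theorem S₁.rot_nu (θ : ℝ) (ζ : ℂ) : (nu ζ).rot θ = nu (ζ + (θ : ℂ)) := by
  apply S₁.chart_injective
  rw [S₁.chart_rot, chart_nu, chart_nu, ← Complex.exp_add]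
  ring_nf

section Smooth

variable {V W M : Type*} [NormedAddCommGroup V] [NormedSpace ℝ V]
    [TopologicalSpace W] {I : ModelWithCorners ℝ V W} [TopologicalSpace M] [ChartedSpace W M]

theorem contMDiff_rot {θ : M → ℝ} {f : M → S₁} (hθ : ContMDiff I 𝓘(ℝ, ℝ) ∞ θ)
    (hf : ContMDiff I 𝓘(ℝ, ℂ) ∞ f) : ContMDiff I 𝓘(ℝ, ℂ) ∞ (fun x => (f x).rot (θ x)) := by
  refine ContMDiff.of_comp_isOpenEmbedding S₁.isOpenEmbedding_chart ?_
  have h : ContDiff ℝ ∞ (fun y : ℝ × ℂ => Complex.exp (y.1 * Complex.I) * y.2) :=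
    ((Complex.ofRealCLM.contDiff.comp contDiff_fst).mul contDiff_const).cexp.mul contDiff_snd
  have h2 := h.contMDiff.comp (hθ.prodMk_space (S₁.contMDiff_chart.comp hf))
  convert h2 using 1
  funext x
  exact S₁.chart_rot _ _

theorem contMDiff_toE {f : M → E} (hf : ContMDiff I 𝓘(ℝ, ℂ × ℂ) ∞ (fun x => (f x : ℂ × ℂ))) :
    ContMDiff I 𝓘(ℝ, ℂ × ℂ) ∞ f :=
  fun x => (ContMDiffAt.subtypeVal_comp_iff E f x).1 (hf x)

end Smooth

/-! ### Twists as a one-parameter group -/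

/-- The rotation of `S₁` at height `t` by the angle `s * ψ t`. -/
def twist (ψ : ℝ → ℝ) (s : ℝ) (p : S₁) : S₁ := p.rot (s * ψ p.height)

theorem height_twist (ψ : ℝ → ℝ) (s : ℝ) (p : S₁) : (twist ψ s p).height = p.height :=
  S₁.height_rot _ _

/-- Rotations preserve the height, so both rotations use the same value of `ψ` and their angles add.
-/
theorem twist_twist (ψ : ℝ → ℝ) (s s' : ℝ) (p : S₁) :
    twist ψ s' (twist ψ s p) = twist ψ (s' + s) p := by
  rw [twist, height_twist, twist, twist, S₁.rot_rot, add_mul]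

theorem twist_zero (ψ : ℝ → ℝ) (p : S₁) : twist ψ 0 p = p := by
  rw [twist, zero_mul, S₁.rot_zero]

theorem twist_nu (ψ : ℝ → ℝ) (s : ℝ) (ζ : ℂ) :
    twist ψ s (nu ζ) = nu (ζ + ((s * ψ ζ.im : ℝ) : ℂ)) := by
  rw [twist, S₁.rot_nu, height_nu]

section Smooth

variable {V W M : Type*} [NormedAddCommGroup V] [NormedSpace ℝ V]
    [TopologicalSpace W] {I : ModelWithCorners ℝ V W} [TopologicalSpace M] [ChartedSpace W M]

theorem contMDiff_twist {ψ : ℝ → ℝ} (hψ : ContDiff ℝ ∞ ψ) {s : M → ℝ} {f : M → S₁}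
    (hs : ContMDiff I 𝓘(ℝ, ℝ) ∞ s) (hf : ContMDiff I 𝓘(ℝ, ℂ) ∞ f) :
    ContMDiff I 𝓘(ℝ, ℂ) ∞ (fun x => twist ψ (s x) (f x)) := by
  refine contMDiff_rot ?_ hf
  exact hs.smul (hψ.contMDiff.comp (S₁.contMDiff_height.comp hf))

end Smooth

/-- `twist ψ s` as a diffeomorphism of `S₁`. -/
def twistDiffeo {ψ : ℝ → ℝ} (hψ : ContDiff ℝ ∞ ψ) (s : ℝ) : S₁ ≃ₘ^∞⟮𝓘(ℝ, ℂ), 𝓘(ℝ, ℂ)⟯ S₁ where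
  toFun := twist ψ s
  invFun := twist ψ (-s)
  left_inv p := by rw [twist_twist, neg_add_cancel, twist_zero]
  right_inv p := by rw [twist_twist, add_neg_cancel, twist_zero]
  contMDiff_toFun := contMDiff_twist hψ contMDiff_const contMDiff_id
  contMDiff_invFun := contMDiff_twist hψ contMDiff_const contMDiff_id

/-- The diffeomorphism `(z, p) ↦ (z, twist ψ (Re z) p)` of `ℂ × S₁`. -/
def shear {ψ : ℝ → ℝ} (hψ : ContDiff ℝ ∞ ψ) :
    (ℂ × S₁) ≃ₘ^∞⟮𝓘(ℝ, ℂ).prod 𝓘(ℝ, ℂ), 𝓘(ℝ, ℂ).prod 𝓘(ℝ, ℂ)⟯ (ℂ × S₁) where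
  toFun x := (x.1, twist ψ x.1.re x.2)
  invFun x := (x.1, twist ψ (-x.1.re) x.2)
  left_inv x := by simp only [twist_twist, neg_add_cancel, twist_zero]
  right_inv x := by simp only [twist_twist, add_neg_cancel, twist_zero]
  contMDiff_toFun := contMDiff_fst.prodMk (contMDiff_twist hψ
    (Complex.reCLM.contDiff.contMDiff.comp contMDiff_fst) contMDiff_snd)
  contMDiff_invFun := contMDiff_fst.prodMk (contMDiff_twist hψ
    ((Complex.reCLM.contDiff.neg).contMDiff.comp contMDiff_fst) contMDiff_snd)

/-! ### The trivialization of `E` pulled back along `π` -/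

/-- The map `ℂ × S₁ → E` over `π : ℂ → B` preserving the function `x + iy`. -/
def fiberMap (x : ℂ × S₁) : E :=
  ⟨ofUV x.2.chart ((piMap x.1).1 * x.2.chart⁻¹), by
    change H _ ≠ 0
    rw [H_ofUV, mul_left_comm, mul_inv_cancel₀ x.2.chart_ne_zero, mul_one]
    exact (piMap x.1).2⟩

theorem HE_fiberMap (x : ℂ × S₁) : HE (fiberMap x) = piMap x.1 := by
  apply Subtype.ext
  change H (ofUV _ _) = _
  rw [H_ofUV, mul_left_comm, mul_inv_cancel₀ x.2.chart_ne_zero, mul_one]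

/-- The point of `S₁` with the same value of `x + iy`. -/
def toFiber (q : E) : S₁ :=
  S₁.param ⟨q.1.1 + Complex.I * q.1.2, fun h => q.2 (by
    rw [← add_mul_sub, h, zero_mul])⟩

theorem chart_toFiber (q : E) : (toFiber q).chart = q.1.1 + Complex.I * q.1.2 := S₁.chart_param _

theorem toFiber_fiberMap (x : ℂ × S₁) : toFiber (fiberMap x) = x.2 := by
  apply S₁.chart_injective
  rw [chart_toFiber]
  exact ofUV_fst_add _ _

theorem fiberMap_toFiber {q : E} {z : ℂ} (h : HE q = piMap z) : fiberMap (z, toFiber q) = q := by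
  apply Subtype.ext
  have h1 : H q.1 = (piMap z).1 := congrArg Subtype.val h
  have h2 : (toFiber q).chart * (q.1.1 - Complex.I * q.1.2) = H q.1 := by
    rw [chart_toFiber, add_mul_sub]
  have h3 : (piMap z).1 * (toFiber q).chart⁻¹ = q.1.1 - Complex.I * q.1.2 := by
    rw [← h1, ← h2]
    field_simp [(toFiber q).chart_ne_zero]
  change ofUV (toFiber q).chart ((piMap z).1 * (toFiber q).chart⁻¹) = q.1
  rw [h3, chart_toFiber, ofUV_add_sub]

theorem contMDiff_toFiber : ContMDiff 𝓘(ℝ, ℂ × ℂ) 𝓘(ℝ, ℂ) ∞ toFiber := by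
  refine ContMDiff.of_comp_isOpenEmbedding S₁.isOpenEmbedding_chart ?_
  have h : ContDiff ℝ ∞ (fun q : ℂ × ℂ => q.1 + Complex.I * q.2) :=
    contDiff_fst.add (contDiff_const.mul contDiff_snd)
  have h2 := h.contMDiff.comp (contMDiff_subtype_val (U := E) (I := 𝓘(ℝ, ℂ × ℂ)))
  convert h2 using 1
  funext q
  exact chart_toFiber q

theorem contMDiff_fiberMap : ContMDiff (𝓘(ℝ, ℂ).prod 𝓘(ℝ, ℂ)) 𝓘(ℝ, ℂ × ℂ) ∞ fiberMap := by
  refine contMDiff_toE fun x => ?_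
  have h : ContDiffAt ℝ ∞ (fun y : ℂ × ℂ =>
      ofUV y.2 (Complex.exp (2 * Real.pi * Complex.I * y.1) * y.2⁻¹)) (x.1, x.2.chart) := by
    have hv : ContDiffAt ℝ ∞ (fun y : ℂ × ℂ =>
        Complex.exp (2 * Real.pi * Complex.I * y.1) * y.2⁻¹) (x.1, x.2.chart) :=
      (contDiffAt_const.mul contDiffAt_fst).cexp.mul (contDiffAt_snd.inv x.2.chart_ne_zero)
    exact ((contDiffAt_snd.add hv).div_const _).prodMk ((contDiffAt_snd.sub hv).div_const _)
  exact ContMDiffAt.comp (f := fun y : ℂ × S₁ => (y.1, y.2.chart)) x h.contMDiffAt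
    (contMDiff_fst.prodMk_space (S₁.contMDiff_chart.comp contMDiff_snd) x)

theorem piMap_eq_iff {z w : ℂ} : piMap z = piMap w ↔ ∃ n : ℤ, z = w + n := by
  have h0 : (2 * Real.pi * Complex.I : ℂ) ≠ 0 := Complex.two_pi_I_ne_zero
  rw [Subtype.ext_iff]
  change Complex.exp _ = Complex.exp _ ↔ _
  rw [Complex.exp_eq_exp_iff_exists_int]
  refine exists_congr fun n => ⟨fun h => mul_left_cancel₀ h0 (by rw [h]; ring), fun h => ?_⟩
  rw [h]; ring

theorem fiberMap_eq_iff {x y : ℂ × S₁} :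
    fiberMap x = fiberMap y ↔ (∃ n : ℤ, x.1 = y.1 + n) ∧ x.2 = y.2 := by
  rw [← piMap_eq_iff]
  constructor
  · intro h
    exact ⟨by rw [← HE_fiberMap, h, HE_fiberMap], by rw [← toFiber_fiberMap, h, toFiber_fiberMap]⟩
  · rintro ⟨h1, h2⟩
    apply Subtype.ext
    simp only [fiberMap, h1, h2]

theorem piMap_surjective : Function.Surjective piMap := fun b => by
  have h0 : (2 * Real.pi * Complex.I : ℂ) ≠ 0 := Complex.two_pi_I_ne_zero
  refine ⟨Complex.log b.1 / (2 * Real.pi * Complex.I), Subtype.ext ?_⟩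
  change Complex.exp _ = _
  rw [mul_div_cancel₀ _ h0, Complex.exp_log b.2]

theorem fiberMap_surjective : Function.Surjective fiberMap := fun q => by
  obtain ⟨z, hz⟩ := piMap_surjective (HE q)
  exact ⟨(z, toFiber q), fiberMap_toFiber hz.symm⟩

/-! ### Local inverses of `π` and of `fiberMap` -/

/-- The branch of `π⁻¹` near `z₀`. -/
def piInv (z₀ : ℂ) (h : ℂ) : ℂ :=
  z₀ + Complex.log (h / (piMap z₀).1) / (2 * Real.pi * Complex.I)

theorem re_div_two_pi_I (w : ℂ) : (w / (2 * Real.pi * Complex.I)).re = w.im / (2 * Real.pi) := by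
  have : w / (2 * Real.pi * Complex.I) = (-(w * Complex.I)) / ((2 * Real.pi : ℝ) : ℂ) := by
    have hI0 : Complex.I ≠ 0 := Complex.I_ne_zero
    have hpi : (Real.pi : ℂ) ≠ 0 := by exact_mod_cast Real.pi_ne_zero
    push_cast
    field_simp
    rw [Complex.I_sq]; ring
  rw [this, Complex.div_ofReal_re]
  simp

theorem piMap_piInv (z₀ : ℂ) (h : B) : piMap (piInv z₀ h.1) = h := by
  apply Subtype.ext
  change Complex.exp (2 * Real.pi * Complex.I * _) = _
  rw [piInv, mul_add, mul_div_cancel₀ _ Complex.two_pi_I_ne_zero, Complex.exp_add,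
    Complex.exp_log (div_ne_zero h.2 (piMap z₀).2)]
  exact mul_div_cancel₀ _ (piMap z₀).2

theorem piMap_div (z z₀ : ℂ) : (piMap z).1 / (piMap z₀).1 =
    Complex.exp (2 * Real.pi * Complex.I * (z - z₀)) := by
  change Complex.exp _ / Complex.exp _ = _
  rw [← Complex.exp_sub]; ring_nf

theorem im_two_pi_I_mul (w : ℂ) : (2 * Real.pi * Complex.I * w).im = 2 * Real.pi * w.re := by
  simp

/-- The bound `1 / 2` keeps the imaginary part of the exponent in `(-π, π)`, where the principal
logarithm inverts `exp`. -/
theorem log_piMap_div {z z₀ : ℂ} (h : |z.re - z₀.re| < 1 / 2) :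
    Complex.log ((piMap z).1 / (piMap z₀).1) = 2 * Real.pi * Complex.I * (z - z₀) := by
  have hpi := Real.pi_pos
  rw [abs_lt] at h
  rw [piMap_div, Complex.log_exp] <;> rw [im_two_pi_I_mul, Complex.sub_re] <;> nlinarith

theorem piInv_piMap {z z₀ : ℂ} (h : |z.re - z₀.re| < 1 / 2) : piInv z₀ (piMap z).1 = z := by
  rw [piInv, log_piMap_div h, mul_div_cancel_left₀ _ Complex.two_pi_I_ne_zero]
  ring

theorem piMap_div_mem_slitPlane {z z₀ : ℂ} (h : |z.re - z₀.re| < 1 / 2) :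
    (piMap z).1 / (piMap z₀).1 ∈ Complex.slitPlane := by
  rw [Complex.mem_slitPlane_iff_arg]
  refine ⟨?_, div_ne_zero (piMap z).2 (piMap z₀).2⟩
  rw [← Complex.log_im, log_piMap_div h, im_two_pi_I_mul, Complex.sub_re]
  rw [abs_lt] at h
  have hpi := Real.pi_pos
  nlinarith

theorem piInv_re {h z₀ : ℂ} (hh : h / (piMap z₀).1 ∈ Complex.slitPlane) :
    |(piInv z₀ h).re - z₀.re| < 1 / 2 := by
  have hpi := Real.pi_pos
  have h1 := (Complex.mem_slitPlane_iff_arg.1 hh).1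
  have h2 := Complex.neg_pi_lt_arg (h / (piMap z₀).1)
  have h3 := lt_of_le_of_ne (Complex.arg_le_pi (h / (piMap z₀).1)) h1
  rw [piInv, Complex.add_re, re_div_two_pi_I, Complex.log_im, add_sub_cancel_left, abs_lt,
    lt_div_iff₀ (by positivity), div_lt_iff₀ (by positivity)]
  constructor <;> linarith

theorem contDiff_H : ContDiff ℝ ∞ H := (contDiff_fst.pow 2).add (contDiff_snd.pow 2)

/-- A strip of width `1` in `Re z` corresponds to the part of `E` where `H / π(z₀)` avoids the cut
of the logarithm; there `piInv` recovers `z`, and `toFiber` recovers `p`. -/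
theorem isLocalDiffeomorph_fiberMap :
    IsLocalDiffeomorph (𝓘(ℝ, ℂ).prod 𝓘(ℝ, ℂ)) 𝓘(ℝ, ℂ × ℂ) ∞ fiberMap := by
  intro x
  have hHc : Continuous (fun q : E => H q.1 / (piMap x.1).1) :=
    (contDiff_H.continuous.comp continuous_subtype_val).div_const _
  let Φ : PartialDiffeomorph (𝓘(ℝ, ℂ).prod 𝓘(ℝ, ℂ)) 𝓘(ℝ, ℂ × ℂ) (ℂ × S₁) E ∞ :=
    { toFun := fiberMap
      invFun := fun q => (piInv x.1 (H q.1), toFiber q)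
      source := {y | |y.1.re - x.1.re| < 1 / 2}
      target := {q | H q.1 / (piMap x.1).1 ∈ Complex.slitPlane}
      map_source' := fun y hy => by
        have h := congrArg Subtype.val (HE_fiberMap y)
        change H (fiberMap y).1 = _ at h
        simp only [Set.mem_ofPred_eq, h]
        exact piMap_div_mem_slitPlane hy
      map_target' := fun q hq => piInv_re hq
      left_inv' := fun y hy => by
        have h := congrArg Subtype.val (HE_fiberMap y)
        change H (fiberMap y).1 = _ at h
        refine Prod.ext ?_ (toFiber_fiberMap y)
        simp only [h]
        exact piInv_piMap hy
      right_inv' := fun q _ => fiberMap_toFiber (piMap_piInv x.1 (HE q)).symm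
      open_source := isOpen_lt (by fun_prop) continuous_const
      open_target := Complex.isOpen_slitPlane.preimage hHc
      contMDiffOn_toFun := contMDiff_fiberMap.contMDiffOn
      contMDiffOn_invFun := by
        refine ContMDiffOn.prodMk (fun q hq => ContMDiffAt.contMDiffWithinAt ?_)
          contMDiff_toFiber.contMDiffOn
        have h : ContDiffAt ℝ ∞ (fun y : ℂ × ℂ => piInv x.1 (H y)) q.1 := by
          have hl : ContDiffAt ℝ ∞ Complex.log (H q.1 / (piMap x.1).1) :=
            (Complex.contDiffAt_log hq).restrict_scalars ℝ
          exact contDiffAt_const.add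
            ((hl.comp q.1 (contDiff_H.contDiffAt.div_const _)).div_const _)
        exact h.contMDiffAt.comp q (contMDiff_subtype_val (U := E) (I := 𝓘(ℝ, ℂ × ℂ)) q) }
  exact ⟨Φ, by simp [Φ], fun _ _ => rfl⟩

/-! ### The covering by translations -/

/-- The action of `ℤ` on `ℂ × S₁` by translations of the first factor. -/
@[reducible]
def translationAction : AddAction ℤ (ℂ × S₁) where
  vadd n x := (x.1 + n, x.2)
  zero_vadd x := Prod.ext (by change x.1 + ((0 : ℤ) : ℂ) = x.1; simp) rfl
  add_vadd m n x := Prod.ext (by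
    change x.1 + ((m + n : ℤ) : ℂ) = x.1 + n + m
    push_cast; ring) rfl

theorem isCoveringMap_fiberMap : IsCoveringMap fiberMap := by
  let := translationAction
  have hv : ∀ (n : ℤ) (x : ℂ × S₁), n +ᵥ x = (x.1 + n, x.2) := fun _ _ => rfl
  have hq : IsAddQuotientCoveringMap fiberMap ℤ :=
    { toIsQuotientMap := isLocalDiffeomorph_fiberMap.isOpenMap.isQuotientMap
        contMDiff_fiberMap.continuous fiberMap_surjective
      continuous_const_vadd := fun n =>
        (continuous_fst.add continuous_const).prodMk continuous_snd
      apply_eq_iff_mem_orbit := fun {x y} => by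
        rw [fiberMap_eq_iff, AddAction.mem_orbit_iff]
        simp only [hv, Prod.ext_iff, eq_comm (a := x.1), eq_comm (a := x.2), exists_and_right]
      disjoint := fun x => by
        -- A nonzero integer translation moves an open strip of width `1` off itself.
        refine ⟨{y | |y.1.re - x.1.re| < 1 / 2},
          (isOpen_lt (by fun_prop) continuous_const).mem_nhds (by simp), fun n => ?_⟩
        rintro ⟨_, ⟨y, hy, rfl⟩, hy'⟩
        simp only [hv, Set.mem_ofPred_eq, Complex.add_re, Complex.intCast_re, abs_lt] at hy hy'
        have h1 : (n : ℝ) < 1 := by linarith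
        have h2 : (-1 : ℝ) < n := by linarith
        have h1' : n < 1 := by exact_mod_cast h1
        have h2' : -1 < n := by exact_mod_cast h2
        omega }
  exact hq.isCoveringMap

/-! ### The twisted covering and its deck group -/

variable {ψ : ℝ → ℝ} (hψ : ContDiff ℝ ∞ ψ)

/-- The covering `ℂ × S₁ → E` unrolling the mapping torus of the twist by `ψ`. -/
def unroll (x : ℂ × S₁) : E := fiberMap (shear hψ x)

theorem HE_unroll (x : ℂ × S₁) : HE (unroll hψ x) = piMap x.1 := HE_fiberMap _

theorem isLocalDiffeomorph_unroll :
    IsLocalDiffeomorph (𝓘(ℝ, ℂ).prod 𝓘(ℝ, ℂ)) 𝓘(ℝ, ℂ × ℂ) ∞ (unroll hψ) := fun x =>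
  ((shear hψ).isLocalDiffeomorph x).comp _ _ (isLocalDiffeomorph_fiberMap (shear hψ x))

theorem unroll_surjective : Function.Surjective (unroll hψ) :=
  fiberMap_surjective.comp (shear hψ).surjective

theorem isSmoothCovering_unroll : IsSmoothCovering (unroll hψ) :=
  ⟨unroll_surjective hψ, isCoveringMap_fiberMap.comp_homeomorph (shear hψ).toHomeomorph,
    isLocalDiffeomorph_unroll hψ⟩

theorem twist_injective (ψ : ℝ → ℝ) (s : ℝ) : Function.Injective (twist ψ s) :=
  Function.LeftInverse.injective (g := twist ψ (-s)) fun p => by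
    rw [twist_twist, neg_add_cancel, twist_zero]

theorem unroll_eq_iff {x y : ℂ × S₁} :
    unroll hψ x = unroll hψ y ↔ ∃ n : ℤ, x = (y.1 + n, twist ψ (-n) y.2) := by
  rw [unroll, unroll, fiberMap_eq_iff, ← exists_and_right]
  refine exists_congr fun n => ?_
  rw [Prod.ext_iff]
  refine and_congr_right fun h => ?_
  change x.1 = y.1 + n at h
  change twist ψ x.1.re x.2 = twist ψ y.1.re y.2 ↔ _
  -- Since `Re x.1 = Re y.1 + n`, the shear angles differ by `n * ψ`, which `twist ψ (-n)`
  -- compensates.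
  have h2 : twist ψ y.1.re y.2 = twist ψ x.1.re (twist ψ (-n) y.2) := by
    rw [twist_twist, h]; simp
  rw [h2, (twist_injective ψ _).eq_iff]

theorem gammaHat₀_zpow {D : S₁ ≃ₜ S₁} (hD : ∀ p, D p = twist ψ (-1) p) (n : ℤ) (x : ℂ × S₁) :
    (gammaHat₀ D ^ n) x = (x.1 + n, twist ψ (-n) x.2) := by
  have hg : ∀ x, gammaHat₀ D x = (x.1 + 1, twist ψ (-1) x.2) := fun x =>
    Prod.ext rfl (hD x.2)
  induction n generalizing x with
  | zero => simp [twist_zero]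
  | succ n ih =>
    rw [zpow_add_one]
    change (gammaHat₀ D ^ (n : ℤ)) (gammaHat₀ D x) = _
    rw [hg, ih, twist_twist]
    push_cast
    ring_nf
  | pred n ih =>
    -- Writing `x` as an image of the generator lets one factor cancel and reduces to the exponent
    -- `-n`.
    have hx : x = gammaHat₀ D (x.1 - 1, twist ψ 1 x.2) := by
      rw [hg]
      simp [twist_twist, twist_zero]
    have h2 : (gammaHat₀ D ^ (-(n : ℤ) - 1)) (gammaHat₀ D (x.1 - 1, twist ψ 1 x.2)) =
        (gammaHat₀ D ^ (-(n : ℤ))) (x.1 - 1, twist ψ 1 x.2) := by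
      change (gammaHat₀ D ^ (-(n : ℤ) - 1) * gammaHat₀ D) _ = _
      rw [← zpow_add_one, sub_add_cancel]
    rw [← hx] at h2
    rw [h2, ih, twist_twist]
    push_cast
    ring_nf

theorem unroll_eq_iff_zpow {D : S₁ ≃ₜ S₁} (hD : ∀ p, D p = twist ψ (-1) p) {x y : ℂ × S₁} :
    unroll hψ x = unroll hψ y ↔ ∃ n : ℤ, (gammaHat₀ D ^ n) y = x := by
  simp only [unroll_eq_iff, gammaHat₀_zpow hD, eq_comm]

/-- A deck transformation agrees at one point with a power of the generator; both lift `unroll`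
through the covering, so they agree on the connected space `ℂ × S₁`. -/
theorem deckGroup_unroll {D : S₁ ≃ₜ S₁} (hD : ∀ p, D p = twist ψ (-1) p) :
    deckGroup (unroll hψ) = GammaHat D := by
  apply le_antisymm
  · intro g hg
    obtain ⟨x₀⟩ : Nonempty (ℂ × S₁) := inferInstance
    obtain ⟨n, hn⟩ := (unroll_eq_iff_zpow hψ hD).1 (hg x₀)
    refine Subgroup.mem_zpowers_iff.2 ⟨n, Homeomorph.ext fun x => ?_⟩
    have hz : ∀ x, unroll hψ ((gammaHat₀ D ^ n) x) = unroll hψ x := fun x =>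
      (unroll_eq_iff_zpow hψ hD).2 ⟨n, rfl⟩
    exact congrFun ((isSmoothCovering_unroll hψ).2.1.eq_of_comp_eq (gammaHat₀ D ^ n).continuous
      g.continuous (funext fun x => (hz x).trans (hg x).symm) x₀ hn) x
  · refine (Subgroup.zpowers_le (G := (ℂ × S₁) ≃ₜ (ℂ × S₁))).2 fun x => ?_
    exact (unroll_eq_iff_zpow hψ hD).2 ⟨1, by rw [zpow_one]⟩

/-! ### The monodromy family -/

theorem isMonodromy_twist {ψ : ℝ → ℝ} (hψ : ContDiff ℝ ∞ ψ) : IsMonodromy (twist ψ 1) := by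
  have hP : ∀ (s : ℝ) (p : S₁), toFiber (unroll hψ ((s : ℂ), p)) = twist ψ s p := fun s p => by
    rw [unroll, toFiber_fiberMap]; rfl
  -- This smooth left inverse, defined on all of `E`, gives injectivity of each `F s` and, by the
  -- chain rule, of its differential.
  have hL : ∀ (s : ℝ) (p : S₁), twist ψ (-s) (toFiber (unroll hψ ((s : ℂ), p))) = p := fun s p => by
    rw [hP, twist_twist, neg_add_cancel, twist_zero]
  -- Over the value `1`, taken at `s = 0` and `s = 1`, the fibre is `S₁` itself and `v = u⁻¹`.
  have hval : ∀ (s : ℝ) (p : S₁), (piMap s).1 = 1 →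
      (unroll hψ ((s : ℂ), p) : ℂ × ℂ) = (twist ψ s p).coe := fun s p hs => by
    change ofUV (twist ψ s p).chart ((piMap s).1 * (twist ψ s p).chart⁻¹) = _
    rw [hs, one_mul, S₁.coe_eq_ofUV]
  have hsm := (isLocalDiffeomorph_unroll hψ).contMDiff
  refine ⟨fun s p => unroll hψ ((s : ℂ), p), ?_, fun s => ⟨?_, ?_, ?_⟩, fun s p => ?_,
    fun p => ?_, fun p => ?_⟩
  · exact hsm.comp ((Complex.ofRealCLM.contDiff.contMDiff.comp contMDiff_fst).prodMk contMDiff_snd)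
  · exact fun p _ => HE_unroll hψ _
  · exact fun p _ p' _ h => (hL s p).symm.trans
      ((congrArg (fun q => twist ψ (-s) (toFiber q)) h).trans (hL s p'))
  · intro q hq
    refine ⟨twist ψ (-s) (toFiber q), trivial, ?_⟩
    change fiberMap ((s : ℂ), twist ψ s (twist ψ (-s) (toFiber q))) = q
    rw [twist_twist, add_neg_cancel, twist_zero]
    exact fiberMap_toFiber hq
  · have hF : ContMDiff 𝓘(ℝ, ℂ) 𝓘(ℝ, ℂ × ℂ) ∞ (fun p : S₁ => unroll hψ ((s : ℂ), p)) :=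
      hsm.comp (contMDiff_const.prodMk contMDiff_id)
    have hG : ContMDiff 𝓘(ℝ, ℂ × ℂ) 𝓘(ℝ, ℂ) ∞ (fun q : E => twist ψ (-s) (toFiber q)) :=
      contMDiff_twist hψ contMDiff_const contMDiff_toFiber
    have hc := mfderiv_comp p (hG.mdifferentiable (by simp) _) (hF.mdifferentiable (by simp) p)
    rw [show (fun q : E => twist ψ (-s) (toFiber q)) ∘ (fun p : S₁ => unroll hψ ((s : ℂ), p)) = id
      from funext (hL s), mfderiv_id] at hc
    intro v w hvw
    have h1 := DFunLike.congr_fun hc v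
    have h2 := DFunLike.congr_fun hc w
    exact h1.trans ((congrArg (mfderiv 𝓘(ℝ, ℂ × ℂ) 𝓘(ℝ, ℂ)
      (fun q : E => twist ψ (-s) (toFiber q)) (unroll hψ ((s : ℂ), p))) hvw).trans h2.symm)
  · rw [hval 0 p (by simp [piMap]), twist_zero]
  · exact hval 1 p (by simp [piMap, Complex.exp_two_pi_mul_I])

/-! ### The quotient by `Γ̂` -/

section Quotient

variable {D : S₁ ≃ₜ S₁} (hD : ∀ p, D p = twist ψ (-1) p)

theorem orbitSetoid_r_iff {ψ : ℝ → ℝ} (hψ : ContDiff ℝ ∞ ψ) {D : S₁ ≃ₜ S₁}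
    (hD : ∀ p, D p = twist ψ (-1) p) {x y : ℂ × S₁} :
    (orbitSetoid D).r x y ↔ unroll hψ x = unroll hψ y := by
  rw [eq_comm, unroll_eq_iff_zpow hψ hD]
  constructor
  · rintro ⟨g, hg, h⟩
    obtain ⟨n, rfl⟩ := Subgroup.mem_zpowers_iff.1 hg
    exact ⟨n, h⟩
  · rintro ⟨n, h⟩
    exact ⟨_, Subgroup.zpow_mem_zpowers _ n, h⟩

/-- The homeomorphism `(ℂ × S₁) / Γ̂ → E` induced by `unroll`. -/
def quotientHomeo : QuotientSpace D ≃ₜ E :=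
  Equiv.toHomeomorphOfContinuousOpen
    (Equiv.ofBijective
      (Quotient.lift (unroll hψ) fun _ _ h => (orbitSetoid_r_iff hψ hD).1 h)
      ⟨by
        rintro ⟨x⟩ ⟨y⟩ h
        exact Quotient.sound ((orbitSetoid_r_iff hψ hD).2 h), fun q => by
        obtain ⟨x, hx⟩ := unroll_surjective hψ q
        exact ⟨toQuotient D x, hx⟩⟩)
    ((isLocalDiffeomorph_unroll hψ).contMDiff.continuous.quotient_lift _)
    (fun U hU => by
      -- Openness descends: the image of `U` is the image of its open preimage in `ℂ × S₁` under the
      -- open map `unroll`.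
      have h : Quotient.lift (unroll hψ) (fun _ _ h => (orbitSetoid_r_iff hψ hD).1 h) '' U =
          unroll hψ '' (toQuotient D ⁻¹' U) := by
        conv_lhs => rw [← Set.image_preimage_eq U (Quotient.mk_surjective (s := orbitSetoid D)),
          ← Set.image_comp]
        rfl
      change IsOpen (Quotient.lift (unroll hψ) (fun _ _ h => (orbitSetoid_r_iff hψ hD).1 h) '' U)
      rw [h]
      exact (isLocalDiffeomorph_unroll hψ).isOpenMap _ (hU.preimage continuous_quotient_mk'))

end Quotient

/-! ### Transport of the smooth structure from `E` -/

section Transfer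

variable {X : Type*} [TopologicalSpace X] (h : X ≃ₜ E)

theorem isOpenEmbedding_toModelProd :
    Topology.IsOpenEmbedding (fun x : X => ((h x : ℂ × ℂ) : ModelProd ℂ ℂ)) :=
  E.isOpenEmbedding'.comp h.isOpenEmbedding

variable [Nonempty X]

/-- The smooth structure on `X` pulled back along a homeomorphism onto `E`. -/
@[reducible]
def transferChartedSpace : ChartedSpace (ModelProd ℂ ℂ) X :=
  (isOpenEmbedding_toModelProd h).singletonChartedSpace

theorem isManifold_transfer :
    let := transferChartedSpace h
    IsManifold (𝓘(ℝ, ℂ).prod 𝓘(ℝ, ℂ)) ∞ X :=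
  (isOpenEmbedding_toModelProd h).isManifold_singleton

/-- The homeomorphism `h : X → E` as a diffeomorphism for the pulled back structure. -/
def transferDiffeo :
    let := transferChartedSpace h
    X ≃ₘ^∞⟮𝓘(ℝ, ℂ).prod 𝓘(ℝ, ℂ), 𝓘(ℝ, ℂ × ℂ)⟯ E :=
  let := transferChartedSpace h
  { toEquiv := h.toEquiv
    contMDiff_toFun := by
      refine contMDiff_toE ?_
      have h1 := contMDiff_isOpenEmbedding (I := 𝓘(ℝ, ℂ).prod 𝓘(ℝ, ℂ)) (n := ∞)
        (isOpenEmbedding_toModelProd h)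
      -- The model of `ℂ × ℂ` and the product of the models of the factors agree, but only after
      -- this rewriting.
      rw [modelWithCornersSelf_prod]
      exact h1
    contMDiff_invFun := by
      refine ContMDiff.of_comp_isOpenEmbedding (isOpenEmbedding_toModelProd h) ?_
      have h1 : (fun x : X => ((h x : ℂ × ℂ) : ModelProd ℂ ℂ)) ∘ h.toEquiv.symm =
          fun q : E => (q : ℂ × ℂ) := by
        funext q
        exact congrArg Subtype.val (h.apply_symm_apply q)
      have h2 := contMDiff_subtype_val (U := E) (I := 𝓘(ℝ, ℂ × ℂ)) (n := ∞)
      change ContMDiff _ _ _ ((fun x : X => ((h x : ℂ × ℂ) : ModelProd ℂ ℂ)) ∘ h.toEquiv.symm)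
      rw [h1, ← modelWithCornersSelf_prod]
      exact h2 }

end Transfer

/-! ### Dehn twists of `C₀` and the circle `δ₀` -/

theorem isDehnTwist_eq_twist {σ : ℤˣ} {D : S₁ ≃ₘ^∞⟮𝓘(ℝ, ℂ), 𝓘(ℝ, ℂ)⟯ S₁} (h : IsDehnTwist σ D) :
    ∃ ψ : ℝ → ℝ, ContDiff ℝ ∞ ψ ∧ (∀ p, D p = twist ψ 1 p) ∧ ∀ p, D.symm p = twist ψ (-1) p := by
  obtain ⟨φ, hφ, -, -, hD⟩ := h
  have h1 : ∀ p, D p = twist (fun t => 2 * Real.pi * (σ : ℤ) * φ t) 1 p := fun p => by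
    obtain ⟨ζ, rfl⟩ := nu_surjective p
    rw [hD, twist_nu, one_mul]
  refine ⟨_, contDiff_const.mul hφ, h1, fun p => D.injective ?_⟩
  change D (D.symm p) = D _
  rw [D.apply_symm_apply, h1, twist_twist, add_neg_cancel, twist_zero]

theorem exists_isDehnTwist (σ : ℤˣ) :
    ∃ D : S₁ ≃ₘ^∞⟮𝓘(ℝ, ℂ), 𝓘(ℝ, ℂ)⟯ S₁, IsDehnTwist σ D := by
  -- `Real.smoothTransition` rises from `0` to `1` on `[0, 1]`; the shift moves this to `[1/2,
  -- 3/2]`.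
  have hφ : ContDiff ℝ ∞ (fun t : ℝ => Real.smoothTransition (t - 1 / 2)) :=
    Real.smoothTransition.contDiff.comp (contDiff_id.sub contDiff_const)
  refine ⟨twistDiffeo (ψ := fun t => 2 * Real.pi * (σ : ℤ) * Real.smoothTransition (t - 1 / 2))
    (contDiff_const.mul hφ) 1, _, hφ, fun t ht => ?_, fun t ht => ?_, fun ζ => ?_⟩
  · exact Real.smoothTransition.zero_of_nonpos (by linarith)
  · exact Real.smoothTransition.one_of_one_le (by linarith)
  · have h := twist_nu (fun t => 2 * Real.pi * (σ : ℤ) * Real.smoothTransition (t - 1 / 2)) 1 ζ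
    rw [one_mul] at h
    exact h

/-- Off `C₀` the angle is `0` or `2πσ`, a whole number of turns. -/
theorem IsDehnTwist.eqOn_symm_id {σ : ℤˣ} {D : S₁ ≃ₘ^∞⟮𝓘(ℝ, ℂ), 𝓘(ℝ, ℂ)⟯ S₁}
    (h : IsDehnTwist σ D) : Set.EqOn D.symm id C₀ᶜ := by
  obtain ⟨φ, -, h0, h1, hD⟩ := h
  intro p hp
  obtain ⟨ζ, rfl⟩ := nu_surjective p
  apply D.injective
  change D (D.symm (nu ζ)) = D (nu ζ)
  rw [D.apply_symm_apply, hD]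
  apply S₁.chart_injective
  rw [chart_nu, chart_nu, add_mul, Complex.exp_add]
  by_cases h2 : ζ.im ≤ 1 / 2
  · simp [h0 _ h2]
  · have h3 : 3 / 2 ≤ ζ.im := by
      by_contra h3
      exact hp ⟨ζ, ⟨not_le.1 h2, not_le.1 h3⟩, rfl⟩
    rw [h1 _ h3]
    have h4 : Complex.exp (((2 * Real.pi * (σ : ℤ) * 1 : ℝ) : ℂ) * Complex.I) = 1 :=
      Complex.exp_eq_one_iff.2 ⟨σ, by push_cast; ring⟩
    rw [h4, mul_one]

/-- At a real point `|x + iy|² = x² + y² = 1`. -/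
theorem height_eq_zero_of_mem_delta₀ {p : S₁} (hp : p ∈ delta₀) : p.height = 0 := by
  obtain ⟨h1, h2⟩ := hp
  have h3 : p.coe.1 ^ 2 + p.coe.2 ^ 2 = 1 := p.2
  have h4 : ‖p.chart‖ ^ 2 = 1 := by
    rw [← Complex.normSq_eq_norm_sq, Complex.normSq_apply]
    have hre := congrArg Complex.re h3
    change (p.coe.1 + Complex.I * p.coe.2).re * (p.coe.1 + Complex.I * p.coe.2).re +
      (p.coe.1 + Complex.I * p.coe.2).im * (p.coe.1 + Complex.I * p.coe.2).im = 1
    simp [pow_two, h1, h2] at hre ⊢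
    exact hre
  have h5 : ‖p.chart‖ = 1 := (pow_eq_one_iff_of_nonneg (norm_nonneg _) two_ne_zero).1 h4
  rw [S₁.height, h5, Real.log_one, neg_zero]

theorem disjoint_delta₀_closure_C₀ : Disjoint delta₀ (closure C₀) := by
  have hcl : closure C₀ ⊆ {p | 1 / 2 ≤ p.height} := by
    refine closure_minimal ?_ (isClosed_le continuous_const S₁.contMDiff_height.continuous)
    rintro _ ⟨ζ, hζ, rfl⟩
    change 1 / 2 ≤ (nu ζ).height
    rw [height_nu]
    exact hζ.1.le
  refine Set.disjoint_left.2 fun p hp hp' => ?_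
  have h1 : 1 / 2 ≤ p.height := hcl hp'
  rw [height_eq_zero_of_mem_delta₀ hp] at h1
  norm_num at h1

end CylinderBundle
end

open CylinderBundle
theorem mainTheorem3 :
    Disjoint delta₀ (closure C₀) ∧
    ∀ σ : ℤˣ,
      -- there are smooth Dehn twists of `C₀` of either handedness
      (∃ Dt : S₁ ≃ₘ^∞⟮𝓘(ℝ, ℂ), 𝓘(ℝ, ℂ)⟯ S₁, IsDehnTwist σ Dt) ∧
      ∀ Dt : S₁ ≃ₘ^∞⟮𝓘(ℝ, ℂ), 𝓘(ℝ, ℂ)⟯ S₁, IsDehnTwist σ Dt →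
        -- `Dt` represents the monodromy around `0` and `D₀ = Dt⁻¹` is the identity off `C₀`
        IsMonodromy Dt ∧
        Set.EqOn Dt.symm id C₀ᶜ ∧
        ∃ P : ℂ × S₁ → E,
          IsSmoothCovering P ∧
          (∀ x : ℂ × S₁, HE (P x) = piMap x.1) ∧
          deckGroup P = GammaHat Dt.symm.toHomeomorph ∧
          -- the quotient manifold `(ℂ × S₁) / Γ̂` is isomorphic to `E` as a bundle over `B`;
          -- its smooth structure is the one for which the quotient map is a local diffeomorphism
          ∃ cs : ChartedSpace (ModelProd ℂ ℂ) (QuotientSpace Dt.symm.toHomeomorph),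
            IsManifold (𝓘(ℝ, ℂ).prod 𝓘(ℝ, ℂ)) ∞ (QuotientSpace Dt.symm.toHomeomorph) ∧
            IsLocalDiffeomorph (𝓘(ℝ, ℂ).prod 𝓘(ℝ, ℂ)) (𝓘(ℝ, ℂ).prod 𝓘(ℝ, ℂ)) ∞
              (toQuotient Dt.symm.toHomeomorph) ∧
            ∃ Φ : QuotientSpace Dt.symm.toHomeomorph
                ≃ₘ^∞⟮𝓘(ℝ, ℂ).prod 𝓘(ℝ, ℂ), 𝓘(ℝ, ℂ × ℂ)⟯ E,
              (∀ x : ℂ × S₁, Φ (toQuotient Dt.symm.toHomeomorph x) = P x) ∧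
              ∀ q : QuotientSpace Dt.symm.toHomeomorph,
                HE (Φ q) = quotientProj Dt.symm.toHomeomorph q := by

  refine ⟨disjoint_delta₀_closure_C₀, fun σ => ⟨exists_isDehnTwist σ, fun Dt hDt => ?_⟩⟩
  obtain ⟨ψ, hψ, hD1, hD2⟩ := isDehnTwist_eq_twist hDt
  have hD : ∀ p, Dt.symm.toHomeomorph p = twist ψ (-1) p := hD2
  refine ⟨?_, hDt.eqOn_symm_id, unroll hψ, isSmoothCovering_unroll hψ, HE_unroll hψ,
    deckGroup_unroll hψ hD, transferChartedSpace (quotientHomeo hψ hD),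
    isManifold_transfer (quotientHomeo hψ hD), ?_, transferDiffeo (quotientHomeo hψ hD),
    fun _ => rfl, ?_⟩
  · rw [show (Dt : S₁ → S₁) = twist ψ 1 from funext hD1]
    exact isMonodromy_twist hψ
  · let := transferChartedSpace (quotientHomeo hψ hD)
    intro x
    -- The quotient map is `Φ⁻¹ ∘ unroll`, a composite of local diffeomorphisms.
    have h := (isLocalDiffeomorph_unroll hψ x).comp _ _
      ((transferDiffeo (quotientHomeo hψ hD)).symm.isLocalDiffeomorph (unroll hψ x))
    rwa [show (transferDiffeo (quotientHomeo hψ hD)).symm ∘ unroll hψ =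
      toQuotient Dt.symm.toHomeomorph from
        funext fun x => (transferDiffeo (quotientHomeo hψ hD)).symm_apply_apply (toQuotient _ x)] at h
  · rintro ⟨x⟩
    exact HE_unroll hψ x
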